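/- Conventions. A partial permutation of $\{1,\dots,n\}$ is an injective function from a subset of $\{1,\dots,n\}$ into $\{1,\dots,n\}$. The symmetric inverse monoid $I_n$ is the monoid of all partial permutations of $\{1,\dots,n\}$ under composition of relations from left to right, and $S_n\le I_n$ is the symmetric group of all permutations. For a set $A$, let $A^*$ be the free monoid of words over $A$. A monoid presentation $\langle A\mid R\rangle$ with $R\subseteq A^*\times A^*$ defines the monoid $A^*/R^\sharp$, where $R^\sharp$ is the least congruence on $A^*$ containing $R$; it is a presentation for (or defines) every monoid isomorphic to $A^*/R^\sharp$. Given such an isomorphism, each word represents an element of that monoid. **Theorem.** (1) Let $n\ge 4$ and let $\langle A\mid R\rangle$ be any monoid presentation for $S_n$, with a chosen isomorphism $A^*/R^\sharp\cong S_n$. Let $\eta\notin A$. Then $I_n$ is defined by the presentation with generators $A\cup\{\eta\}$ and relations $R$ together with the following three relations: $$(2,3)\,\eta=\eta\,(2,3),\qquad (2,3,\dots,n)\,\eta=\eta^2\,(2,3,\dots,n),\qquad (1,2)\,\eta\,(1,2)\,\eta\,(1,2)\,\eta\,(1,2)=\eta\,(1,2)\,\eta,$$ where $(2,3)$, $(2,3,\dots,n)$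 and $(1,2)$ denote any words in $A^*$ representing these permutations. In this presentation every letter of $A$ represents the permutation it represents in $S_n$, and $\eta$ represents the idempotent of rank $n-1$ with domain $\{2,\dots,n\}$. (2) Let $n\ge 3$. Every monoid presentation for $I_n$ requires at least $3$ non-$S_n$ relations, that is: every presentation $\langle C\mid T\rangle$ for $I_n$ contains at least $3$ relations $(u,v)\in T$ for which the element of $I_n$ represented by $u$ (equivalently, by $v$) is not a permutation; and whenever $\langle A\mid R\rangle$ is a presentation for $S_n$ and $\langle A\cup B\mid R\cup S\rangle$, with $A\cap B=\varnothing$, is a presentation for $I_n$, then $|S|\ge 3$. -/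

import Mathlib

/-- The symmetric inverse monoid of degree `n`: all partial permutations (injective partial
transformations) of an `n`-element set. The points `1, …, n` are the elements `0, …, n - 1` of
`Fin n`. -/
def SymInvMonoid (n : ℕ) : Type := Fin n ≃. Fin n

/-- The operation is composition of relations from left to right: `f * g` is `f`, then `g`. -/
instance SymInvMonoid.instMonoid (n : ℕ) : Monoid (SymInvMonoid n) where
  mul f g := PEquiv.trans f g
  one := PEquiv.refl (Fin n)
  mul_assoc f g h := PEquiv.trans_assoc f g h
  one_mul f := PEquiv.refl_trans f
  mul_one f := PEquiv.trans_refl f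

/-- A permutation, regarded as a partial permutation. -/
def SymInvMonoid.ofPerm {n : ℕ} (σ : Equiv.Perm (Fin n)) : SymInvMonoid n := σ.toPEquiv

/-- The symmetric group of degree `n`, as the submonoid of all permutations in the symmetric
inverse monoid (so permutations, too, are composed from left to right). -/
def symGroup (n : ℕ) : Submonoid (SymInvMonoid n) where
  carrier := Set.range SymInvMonoid.ofPerm
  one_mem' := ⟨Equiv.refl _, Equiv.toPEquiv_refl⟩
  mul_mem' := by
    rintro _ _ ⟨σ, rfl⟩ ⟨τ, rfl⟩
    exact ⟨σ.trans τ, Equiv.toPEquiv_trans σ τ⟩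

/-- A permutation as an element of the symmetric group. -/
def symGroup.ofPerm {n : ℕ} (σ : Equiv.Perm (Fin n)) : symGroup n :=
  ⟨SymInvMonoid.ofPerm σ, σ, rfl⟩

/-- The idempotent of rank `n - 1` whose domain omits only the first point: the partial identity
on all points but the first. -/
def etaIdem (n : ℕ) : SymInvMonoid n := PEquiv.ofSet {i : Fin n | (i : ℕ) ≠ 0}

/-- The monoid `A* / R^♯` defined by the monoid presentation `⟨A | R⟩`. -/
abbrev DefinedMonoid {A : Type*} (R : Set (FreeMonoid A × FreeMonoid A)) : Type _ :=
  PresentedMonoid (fun u v : FreeMonoid A => (u, v) ∈ R)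

/-- The element of the monoid defined by `⟨A | R⟩` that a word over `A` represents. -/
abbrev DefinedMonoid.mk {A : Type*} (R : Set (FreeMonoid A × FreeMonoid A)) :
    FreeMonoid A →* DefinedMonoid R :=
  PresentedMonoid.mk (fun u v : FreeMonoid A => (u, v) ∈ R)

/-- A relation over the alphabet `A`, read over a larger alphabet `C` along `i : A → C`. -/
def mapRel {A C : Type*} (i : A → C) (p : FreeMonoid A × FreeMonoid A) :
    FreeMonoid C × FreeMonoid C :=
  (FreeMonoid.map i p.1, FreeMonoid.map i p.2)

/-- The three relations `(2,3) η = η (2,3)`, `(2,…,n) η = η² (2,…,n)` and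
`(1,2) η (1,2) η (1,2) η (1,2) = η (1,2) η` over the alphabet `A ∪ {η}`, modelled as `Option A`
with `η = none`. The words `s`, `b`, `t` over `A` stand for `(2,3)`, `(2,…,n)` and `(1,2)`. -/
def extraRels {A : Type*} (s b t : FreeMonoid A) :
    Set (FreeMonoid (Option A) × FreeMonoid (Option A)) :=
  let ι : FreeMonoid A →* FreeMonoid (Option A) := FreeMonoid.map some
  let η : FreeMonoid (Option A) := FreeMonoid.of none
  {(ι s * η, η * ι s),
   (ι b * η, η ^ 2 * ι b),
   (ι t * η * ι t * η * ι t * η * ι t, η * ι t * η)}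

/-- The non-`Sₙ` relations of a presentation `⟨C | T⟩` of the symmetric inverse monoid: those
that represent an element which is not a permutation. (Both sides represent the same element.) -/
def nonSymRels {n : ℕ} {C : Type*} (T : Set (FreeMonoid C × FreeMonoid C))
    (e : DefinedMonoid T ≃* SymInvMonoid n) : Set (FreeMonoid C × FreeMonoid C) :=
  {p ∈ T | e (DefinedMonoid.mk T p.1) ∉ symGroup n}

/-!
**The presentation.** In the extended monoid, conjugation by `b = (2,…,n)` and the relation
`b η = η² b` show that the permutations commuting with `η` are closed under conjugation by `b`
(`commute_conj`). As they contain `(2,3)`, they contain the whole stabilizer of the first point, and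
so `b` itself; hence `η = η²`. The third relation then says that `η` commutes with its conjugate by
`(1,2)` and that the product of the two absorbs `(1,2)` (`commute_and_absorb_of_rel`). These facts
(`IsPuncture`) allow every element to be written as a product of conjugates `η_i` of `η`, for `i` in
a set `D`, followed by a permutation, which matters only outside of `D`
(`IsPuncture.exists_listIdem_mul`, `IsPuncture.listIdem_mul_eq`). Such normal forms correspond to
partial permutations, `D` being the complement of the domain
(`SymInvMonoid.bijective_of_isPuncture`).

**The lower bound.** A partial permutation has rank at least `n - 1` if and only if it extends to
only one permutation, and then the extension is multiplicative. The elements of smaller rank form an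
ideal, so equalities between elements of rank at least `n - 1` follow from the relations of such
rank alone (`eq_of_wordVal_eq`).

* There is a relation of rank at most `n - 2` (`exists_not_hasUniqueExtension`). Otherwise the sign
  of the extension would be a homomorphism on the whole monoid, although `0 σ = 0` for odd `σ`.
* There are two relations of rank `n - 1` (`corankOneRels_nontrivial`). A homomorphism from words
  to a monoid `K` that sends permutations to their signs and respects the relations of
  rank `n - 1` must send the letters `c` of rank `n - 1`, up to the sign of their extension, to
  idempotents that commute with the sign `-1` (`weight_idem_and_commute`). If there is just one relation,
  counting the letters of rank `n - 1` modulo a suitable number, or with a nilpotent weight, leaves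
  only the form `x₀ c x₁ = y₀ c y₁ c y₂` with permutations `xᵢ`, `yᵢ`. For each pattern of signs
  of these permutations there is a `2 × 2` matrix over the field with two elements that solves the
  equation and does not commute with the sign (`exists_signMatrix_solution`).
-/

/-! ### Normal forms over an idempotent and the permutations -/

section ConjugateIdempotents

open Equiv

variable {M α : Type*} [Monoid M]

theorem map_mul_map_inv (ψ : Perm α →* M) (σ : Perm α) : ψ σ * ψ σ⁻¹ = 1 := by
  rw [← map_mul, mul_inv_cancel, map_one]

theorem map_inv_mul_map (ψ : Perm α →* M) (σ : Perm α) : ψ σ⁻¹ * ψ σ = 1 := by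
  rw [← map_mul, inv_mul_cancel, map_one]

variable [DecidableEq α]

/-- The conjugate of `η` by the transposition of `o` and `i`. If `η` is an idempotent that commutes
with the image of the stabilizer of `o`, this is the conjugate of `η` by any permutation that takes
`o` to `i`. -/
def conjIdem (ψ : Perm α →* M) (η : M) (o i : α) : M :=
  ψ (swap o i) * η * ψ (swap o i)

/-- The idempotent `η` of a monoid `M` behaves, with respect to the images of the permutations
under `ψ`, like the partial identity undefined at `o` only: it commutes with the stabilizer
of `o`, and for one (hence every) pair of points the two conjugates of `η` at these points commute,
and their product absorbs the transposition of the two points. -/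
structure IsPuncture (ψ : Perm α →* M) (η : M) (o : α) : Prop where
  idem : η * η = η
  stab : ∀ σ : Perm α, σ o = o → Commute (ψ σ) η
  pair : ∃ a b : α, a ≠ b ∧ Commute (conjIdem ψ η o a) (conjIdem ψ η o b) ∧
    conjIdem ψ η o a * conjIdem ψ η o b * ψ (swap a b) = conjIdem ψ η o a * conjIdem ψ η o b

@[simp]
theorem conjIdem_self (ψ : Perm α →* M) (η : M) (o : α) : conjIdem ψ η o o = η := by
  rw [conjIdem, swap_self, ← Perm.one_def, map_one, one_mul, mul_one]

theorem map_swap_mul_self (ψ : Perm α →* M) (i j : α) : ψ (swap i j) * ψ (swap i j) = 1 := by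
  rw [← map_mul, swap_mul_self, map_one]

namespace IsPuncture

variable {ψ : Perm α →* M} {η : M} {o : α}

theorem map_mul_conjIdem (h : IsPuncture ψ η o) (σ : Perm α) (i : α) :
    ψ σ * conjIdem ψ η o i = conjIdem ψ η o (σ i) * ψ σ := by
  -- the permutation `(o σi) σ (o i)` fixes `o`, so its image commutes with `η`
  have hfix : (swap o (σ i) * σ * swap o i) o = o := by simp
  have hcomm := h.stab _ hfix
  have h1 : ψ σ * ψ (swap o i) = ψ (swap o (σ i)) * ψ (swap o (σ i) * σ * swap o i) := by
    rw [← map_mul, ← map_mul, ← mul_assoc, ← mul_assoc, swap_mul_self, one_mul]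
  have h2 : ψ (swap o (σ i) * σ * swap o i) * ψ (swap o i) = ψ (swap o (σ i)) * ψ σ := by
    rw [← map_mul, ← map_mul, mul_assoc, swap_mul_self, mul_one]
  calc ψ σ * conjIdem ψ η o i
      = (ψ σ * ψ (swap o i)) * η * ψ (swap o i) := by simp only [conjIdem, mul_assoc]
    _ = ψ (swap o (σ i)) * (ψ (swap o (σ i) * σ * swap o i) * η) * ψ (swap o i) := by
        rw [h1]; simp only [mul_assoc]
    _ = ψ (swap o (σ i)) * η * (ψ (swap o (σ i) * σ * swap o i) * ψ (swap o i)) := by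
        rw [hcomm.eq]; simp only [mul_assoc]
    _ = conjIdem ψ η o (σ i) * ψ σ := by rw [h2]; simp only [conjIdem, mul_assoc]

theorem conjIdem_apply (h : IsPuncture ψ η o) (σ : Perm α) (i : α) :
    conjIdem ψ η o (σ i) = ψ σ * conjIdem ψ η o i * ψ σ⁻¹ := by
  rw [h.map_mul_conjIdem, mul_assoc, map_mul_map_inv, mul_one]

theorem conjIdem_mul_self (h : IsPuncture ψ η o) (i : α) :
    conjIdem ψ η o i * conjIdem ψ η o i = conjIdem ψ η o i := by
  calc conjIdem ψ η o i * conjIdem ψ η o i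
      = ψ (swap o i) * η * (ψ (swap o i) * ψ (swap o i)) * η * ψ (swap o i) := by
        simp only [conjIdem, mul_assoc]
    _ = ψ (swap o i) * (η * η) * ψ (swap o i) := by
        rw [map_swap_mul_self, mul_one]; simp only [mul_assoc]
    _ = conjIdem ψ η o i := by rw [h.idem, conjIdem]

/-- The group of permutations is 2-transitive, so both parts of the hypothesis on one pair of points
carry over to all pairs. -/
theorem pair_all (h : IsPuncture ψ η o) {i j : α} (hij : i ≠ j) :
    Commute (conjIdem ψ η o i) (conjIdem ψ η o j) ∧
    conjIdem ψ η o i * conjIdem ψ η o j * ψ (swap i j) =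
      conjIdem ψ η o i * conjIdem ψ η o j := by
  obtain ⟨a, b, hab, hc, hs⟩ := h.pair
  obtain ⟨σ, rfl, rfl⟩ : ∃ σ : Perm α, σ a = i ∧ σ b = j := by
    refine ⟨swap (swap a i b) j * swap a i, ?_, by simp⟩
    have : i ≠ swap a i b := fun hi => hab <| (swap a i).injective (by simpa using hi)
    simp [swap_apply_of_ne_of_ne this hij]
  have hprod : ∀ x y, conjIdem ψ η o (σ x) * conjIdem ψ η o (σ y) =
      ψ σ * (conjIdem ψ η o x * conjIdem ψ η o y) * ψ σ⁻¹ := fun x y => by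
    rw [h.conjIdem_apply σ y, ← mul_assoc, ← mul_assoc, ← h.map_mul_conjIdem]
    simp only [mul_assoc]
  refine ⟨?_, ?_⟩
  · rw [commute_iff_eq, hprod, hprod, hc.eq]
  · rw [hprod, swap_apply_apply, map_mul, map_mul]
    calc _ = ψ σ * (conjIdem ψ η o a * conjIdem ψ η o b) * (ψ σ⁻¹ * ψ σ) * ψ (swap a b) * ψ σ⁻¹ := by
          simp only [mul_assoc]
      _ = ψ σ * (conjIdem ψ η o a * conjIdem ψ η o b * ψ (swap a b)) * ψ σ⁻¹ := by
          rw [map_inv_mul_map, mul_one]; simp only [mul_assoc]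
      _ = _ := by rw [hs]

theorem commute_conjIdem (h : IsPuncture ψ η o) (i j : α) :
    Commute (conjIdem ψ η o i) (conjIdem ψ η o j) := by
  by_cases hij : i = j
  · rw [hij]
  · exact (h.pair_all hij).1

end IsPuncture

/-- The product of the conjugates of `η` at the points of a list; in the symmetric inverse monoid,
the partial identity undefined on that list. -/
def listIdem (ψ : Perm α →* M) (η : M) (o : α) (l : List α) : M :=
  (l.map (conjIdem ψ η o)).prod

@[simp]
theorem listIdem_nil (ψ : Perm α →* M) (η : M) (o : α) : listIdem ψ η o [] = 1 := rfl

@[simp]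
theorem listIdem_cons (ψ : Perm α →* M) (η : M) (o i : α) (l : List α) :
    listIdem ψ η o (i :: l) = conjIdem ψ η o i * listIdem ψ η o l := by
  simp [listIdem]

namespace IsPuncture

variable {ψ : Perm α →* M} {η : M} {o : α}

theorem commute_conjIdem_listIdem (h : IsPuncture ψ η o) (i : α) (l : List α) :
    Commute (conjIdem ψ η o i) (listIdem ψ η o l) := by
  induction l with
  | nil => simp
  | cons j l ih => rw [listIdem_cons]; exact (h.commute_conjIdem i j).mul_right ih

theorem commute_listIdem (h : IsPuncture ψ η o) (k l : List α) :
    Commute (listIdem ψ η o k) (listIdem ψ η o l) := by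
  induction k with
  | nil => simp
  | cons j k ih => rw [listIdem_cons]; exact (h.commute_conjIdem_listIdem j l).mul_left ih

theorem conjIdem_mul_listIdem_of_mem (h : IsPuncture ψ η o) {i : α} {l : List α} (hi : i ∈ l) :
    conjIdem ψ η o i * listIdem ψ η o l = listIdem ψ η o l := by
  induction l with
  | nil => simp at hi
  | cons j l ih =>
    rw [listIdem_cons, ← mul_assoc]
    rcases List.mem_cons.1 hi with rfl | hi
    · rw [h.conjIdem_mul_self]
    · rw [(h.commute_conjIdem i j).eq, mul_assoc, ih hi]

theorem listIdem_mul_listIdem_of_subset (h : IsPuncture ψ η o) {k l : List α} (hkl : k ⊆ l) :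
    listIdem ψ η o k * listIdem ψ η o l = listIdem ψ η o l := by
  induction k with
  | nil => simp
  | cons j k ih =>
    rw [List.cons_subset] at hkl
    rw [listIdem_cons, mul_assoc, ih hkl.2, h.conjIdem_mul_listIdem_of_mem hkl.1]

theorem listIdem_congr (h : IsPuncture ψ η o) {k l : List α} (hkl : ∀ i, i ∈ k ↔ i ∈ l) :
    listIdem ψ η o k = listIdem ψ η o l := by
  rw [← h.listIdem_mul_listIdem_of_subset (fun i hi => (hkl i).2 hi),
    (h.commute_listIdem l k).eq, h.listIdem_mul_listIdem_of_subset (fun i hi => (hkl i).1 hi)]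

theorem listIdem_mul_swap (h : IsPuncture ψ η o) {l : List α} {i j : α} (hi : i ∈ l) (hj : j ∈ l) :
    listIdem ψ η o l * ψ (swap i j) = listIdem ψ η o l := by
  by_cases hij : i = j
  · rw [hij, swap_self, ← Perm.one_def, map_one, mul_one]
  have hl : listIdem ψ η o l * (conjIdem ψ η o i * conjIdem ψ η o j) = listIdem ψ η o l := by
    rw [← mul_assoc, ← (h.commute_conjIdem_listIdem i l).eq, h.conjIdem_mul_listIdem_of_mem hi,
      ← (h.commute_conjIdem_listIdem j l).eq, h.conjIdem_mul_listIdem_of_mem hj]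
  rw [← hl, mul_assoc, (h.pair_all hij).2]

/-- The idempotent at a list absorbs all permutations supported on that list: these are products of
transpositions of points of the list. -/
theorem listIdem_mul_of_support (h : IsPuncture ψ η o) [Finite α] {l : List α} {τ : Perm α}
    (hτ : ∀ x, x ∉ l → τ x = x) : listIdem ψ η o l * ψ τ = listIdem ψ η o l := by
  obtain ⟨τ, rfl⟩ : ∃ τ' : Perm {x // x ∈ l}, Perm.ofSubtype τ' = τ := by
    have h1 : ∀ x, τ x ≠ x → x ∈ l := fun x hx => by
      by_contra hl; exact hx (hτ x hl)
    have h2 : ∀ x, τ x ∈ l ↔ x ∈ l := fun x => by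
      by_cases hx : τ x = x
      · rw [hx]
      · exact ⟨fun _ => h1 x hx, fun _ => h1 _ fun hh => hx (τ.injective hh)⟩
    exact ⟨τ.subtypePerm h2, Perm.ofSubtype_subtypePerm h2 h1⟩
  clear hτ
  induction τ using Perm.swap_induction_on with
  | one => simp
  | swap_mul f x y _ ih =>
    rw [map_mul, map_mul, Perm.ofSubtype_swap_eq, ← mul_assoc, h.listIdem_mul_swap x.2 y.2, ih]

theorem listIdem_mul_eq (h : IsPuncture ψ η o) [Finite α] {k l : List α} {σ τ : Perm α}
    (hkl : ∀ i, i ∈ k ↔ i ∈ l) (hστ : ∀ x, x ∉ l → σ⁻¹ x = τ⁻¹ x) :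
    listIdem ψ η o k * ψ σ = listIdem ψ η o l * ψ τ := by
  have : listIdem ψ η o l * ψ (τ * σ⁻¹) = listIdem ψ η o l :=
    h.listIdem_mul_of_support fun x hx => by rw [Perm.mul_apply, hστ x hx]; simp
  rw [h.listIdem_congr hkl, ← this, mul_assoc, ← map_mul, inv_mul_cancel_right, this]

/-- Every element of a monoid generated by `η` and the permutations is a normal form. -/
theorem exists_listIdem_mul (h : IsPuncture ψ η o)
    (hgen : Submonoid.closure (insert η (Set.range ψ)) = ⊤) (m : M) :
    ∃ (l : List α) (σ : Perm α), m = listIdem ψ η o l * ψ σ := by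
  have hm : m ∈ Submonoid.closure (insert η (Set.range ψ)) := hgen ▸ Submonoid.mem_top m
  induction hm using Submonoid.closure_induction_right with
  | one => exact ⟨[], 1, by simp⟩
  | mul_right x hx y hy ih =>
    obtain ⟨l, σ, rfl⟩ := ih
    rcases hy with rfl | ⟨τ, rfl⟩
    · refine ⟨σ o :: l, σ, ?_⟩
      have := h.map_mul_conjIdem σ o
      rw [conjIdem_self] at this
      rw [mul_assoc, this, ← mul_assoc, listIdem_cons, (h.commute_conjIdem_listIdem _ _).eq]
    · exact ⟨l, σ * τ, by rw [map_mul, mul_assoc]⟩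

end IsPuncture

/-- In terms of `f = t e t`, the relation `h3` reads `f e f = e t e`, and `e t e` is both `e f t` and
`t f e`. Multiplying by `f` from the left and from the right gives `f e f = e f` and
`f e f = f e`. -/
theorem commute_and_absorb_of_rel {e t : M} (ht : t * t = 1) (he : e * e = e)
    (h3 : t * e * t * e * t * e * t = e * t * e) :
    Commute e (t * e * t) ∧ e * (t * e * t) * t = e * (t * e * t) := by
  obtain ⟨f, hf⟩ : ∃ f, f = t * e * t := ⟨_, rfl⟩
  have htt : ∀ x, t * (t * x) = x := fun x => by rw [← mul_assoc, ht, one_mul]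
  have hee : ∀ x, e * (e * x) = e * x := fun x => by rw [← mul_assoc, he]
  have hff : f * f = f := by
    rw [hf]; simp only [mul_assoc, htt, hee]
  have hft : f * t = t * e := by rw [hf, mul_assoc, ht, mul_one]
  have htf : t * f = e * t := by rw [hf]; simp only [mul_assoc, htt]
  have h1 : f * e * f = e * f * t := by
    rw [mul_assoc e, hft, ← mul_assoc, ← h3, hf]; simp only [mul_assoc]
  have h2 : f * e * f = t * f * e := by
    rw [htf, ← h3, hf]; simp only [mul_assoc]
  have hfe : f * e * f = e * f := by
    have : f * (f * e * f) * t = f * (e * f * t) * t := by rw [h1]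
    simp only [← mul_assoc, hff] at this
    calc f * e * f = f * e * f * t * t := by rw [mul_assoc _ t t, ht, mul_one]
      _ = f * e * f * (t * t) * t := by rw [this]; simp only [mul_assoc]
      _ = e * f * t * t := by rw [ht, mul_one, h1]
      _ = e * f := by rw [mul_assoc _ t t, ht, mul_one]
  have hfe' : f * e * f = f * e := by
    have : t * (f * e * f) = t * (f * e) := by
      rw [← mul_assoc t, ← mul_assoc t, ← h2, mul_assoc _ f f, hff]
    calc f * e * f = t * (t * (f * e * f)) := (htt _).symm
      _ = f * e := by rw [this, htt]
  rw [← hf]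
  exact ⟨by rw [commute_iff_eq, ← hfe, hfe'], by rw [← h1, hfe]⟩

end ConjugateIdempotents

/-! ### The stabilizer of the first point -/

section Stabilizer

open Equiv

variable {M : Type*} [Monoid M] {n : ℕ}

/-- If `b⁻¹` conjugates `η` to `η²`, then the permutations commuting with `η` are closed under
conjugation by `b`: they commute with `η²`, which `b` takes back to `η`. -/
theorem commute_conj {α : Type*} {ψ : Perm α →* M} {η : M} {b σ : Perm α}
    (hb : ψ b⁻¹ * η = η ^ 2 * ψ b⁻¹) (hσ : Commute (ψ σ) η) :
    Commute (ψ (b * σ * b⁻¹)) η := by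
  have h1 : ψ b⁻¹ * ψ (b * σ * b⁻¹) = ψ σ * ψ b⁻¹ := by
    rw [← map_mul, ← map_mul]; congr 1; group
  have h2 : ψ b⁻¹ * (ψ (b * σ * b⁻¹) * η) = ψ b⁻¹ * (η * ψ (b * σ * b⁻¹)) := by
    rw [← mul_assoc, h1, mul_assoc, hb, ← mul_assoc, ((hσ.pow_right 2)).eq, ← mul_assoc, hb,
      mul_assoc, mul_assoc, h1]
  have h3 := congrArg (ψ b * ·) h2
  simp only [← mul_assoc, map_mul_map_inv, one_mul] at h3
  exact h3

/-- A submonoid of `Perm (Fin n)` that contains the transposition `(1 2)` and is closed under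
conjugation by the cycle `(1 2 … n-1)` contains the stabilizer of `0`. -/
theorem stabilizer_le_of_conj_mem (hn : 3 ≤ n) {H : Submonoid (Perm (Fin n))}
    (hs : swap ⟨1, by omega⟩ ⟨2, by omega⟩ ∈ H)
    (hb : ∀ σ ∈ H, Fin.cycleIcc ⟨1, by omega⟩ ⟨n - 1, by omega⟩ * σ *
      (Fin.cycleIcc ⟨1, by omega⟩ ⟨n - 1, by omega⟩)⁻¹ ∈ H)
    {σ : Perm (Fin n)} (hσ : σ ⟨0, by omega⟩ = ⟨0, by omega⟩) : σ ∈ H := by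
  have : NeZero n := ⟨by omega⟩
  have hcyc : ∀ i (hi : i + 1 < n), 1 ≤ i → Fin.cycleIcc (⟨1, by omega⟩ : Fin n)
      ⟨n - 1, by omega⟩ ⟨i, by omega⟩ = ⟨i + 1, hi⟩ := by
    intro i hi h1
    rw [Fin.cycleIcc_of_ge_of_lt (by simpa [Fin.le_def] using h1)
      (by simp [Fin.lt_def]; omega)]
    ext
    rw [Fin.val_add_one_of_lt' (by simpa using hi)]
  have hadj : ∀ i (hi : i + 2 < n), swap (⟨i + 1, by omega⟩ : Fin n) ⟨i + 2, hi⟩ ∈ H := by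
    intro i
    induction i with
    | zero => intro _; exact hs
    | succ i ih =>
      intro hi
      have := hb _ (ih (by omega))
      rwa [← swap_apply_apply, hcyc _ _ (by omega), hcyc _ _ (by omega)] at this
  have hone : ∀ i (hi : i + 1 < n), swap (⟨1, by omega⟩ : Fin n) ⟨i + 1, hi⟩ ∈ H := by
    intro i
    induction i with
    | zero => intro _; rw [swap_self]; exact H.one_mem
    | succ i ih =>
      intro hi
      rcases Nat.eq_zero_or_pos i with rfl | hpos
      · exact hs
      have h1 := H.mul_mem (H.mul_mem (hadj i (by omega)) (ih (by omega))) (hadj i (by omega))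
      have h2 := swap_apply_apply (swap (⟨i + 1, by omega⟩ : Fin n) ⟨i + 2, hi⟩)
        (⟨1, by omega⟩ : Fin n) ⟨i + 1, by omega⟩
      rw [swap_inv] at h2
      rw [← h2] at h1
      rwa [swap_apply_left, swap_apply_of_ne_of_ne (by simp; omega) (by simp)] at h1
  have hswap : ∀ i j : Fin n, (i : ℕ) ≠ 0 → (j : ℕ) ≠ 0 → swap i j ∈ H := by
    rintro ⟨i, hi⟩ ⟨j, hj⟩ hi0 hj0
    obtain ⟨i, rfl⟩ := Nat.exists_eq_succ_of_ne_zero hi0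
    obtain ⟨j, rfl⟩ := Nat.exists_eq_succ_of_ne_zero hj0
    by_cases hj1 : j = 0
    · subst hj1; rw [swap_comm]; exact hone _ hi
    by_cases hij : i = j
    · subst hij; rw [swap_self]; exact H.one_mem
    have h1 := H.mul_mem (H.mul_mem (hone i hi) (hone j hj)) (hone i hi)
    have h2 := swap_apply_apply (swap (⟨1, by omega⟩ : Fin n) ⟨i + 1, hi⟩)
        (⟨1, by omega⟩ : Fin n) ⟨j + 1, hj⟩
    rw [swap_inv] at h2
    rw [← h2] at h1
    rwa [swap_apply_left, swap_apply_of_ne_of_ne (fun h => hj1 (Nat.succ_injective (Fin.mk.inj h)))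
      (fun h => hij (Nat.succ_injective (Fin.mk.inj h)).symm)] at h1
  have h2 : ∀ x : Fin n, (x : ℕ) ≠ 0 ↔ x ≠ ⟨0, by omega⟩ := fun x => by
    rw [Ne, Ne, Fin.ext_iff]
  have hmem : ∀ x, (σ x : ℕ) ≠ 0 ↔ (x : ℕ) ≠ 0 := fun x => by
    rw [h2, h2, Ne, Ne, ← σ.injective.eq_iff (a := x), hσ]
  obtain ⟨τ, rfl⟩ : ∃ τ : Perm {x : Fin n // (x : ℕ) ≠ 0}, Perm.ofSubtype τ = σ :=
    ⟨σ.subtypePerm hmem, Perm.ofSubtype_subtypePerm hmem fun x hx =>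
      (h2 x).2 fun h0 => hx (by rw [h0, hσ])⟩
  clear hσ hmem hcyc hadj hone h2
  induction τ using Perm.swap_induction_on with
  | one => rw [map_one]; exact H.one_mem
  | swap_mul f x y _ ih =>
    rw [map_mul, Perm.ofSubtype_swap_eq]
    exact H.mul_mem (hswap _ _ x.2 y.2) ih

/-- The permutations commuting with `η` contain the stabilizer of `0`. In particular `b` commutes
with `η`, so that `b η = η² b` gives `η = η²`. -/
theorem isPuncture_of_rels (hn : 3 ≤ n) {ψ : Perm (Fin n) →* M} {η : M}
    (h1 : Commute (ψ (swap ⟨1, by omega⟩ ⟨2, by omega⟩)) η)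
    (h2 : ψ (Fin.cycleIcc ⟨1, by omega⟩ ⟨n - 1, by omega⟩)⁻¹ * η =
      η ^ 2 * ψ (Fin.cycleIcc ⟨1, by omega⟩ ⟨n - 1, by omega⟩)⁻¹)
    (h3 : ψ (swap ⟨0, by omega⟩ ⟨1, by omega⟩) * η * ψ (swap ⟨0, by omega⟩ ⟨1, by omega⟩) * η *
        ψ (swap ⟨0, by omega⟩ ⟨1, by omega⟩) * η * ψ (swap ⟨0, by omega⟩ ⟨1, by omega⟩) =
      η * ψ (swap ⟨0, by omega⟩ ⟨1, by omega⟩) * η) :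
    IsPuncture ψ η ⟨0, by omega⟩ := by
  have hstab : ∀ σ : Perm (Fin n), σ ⟨0, by omega⟩ = ⟨0, by omega⟩ → Commute (ψ σ) η := by
    intro σ hσ
    let H : Submonoid (Perm (Fin n)) := (Submonoid.centralizer {η}).comap ψ
    have hH : ∀ τ, τ ∈ H ↔ Commute (ψ τ) η := fun τ => by
      simp only [H, Submonoid.mem_comap, Submonoid.mem_centralizer_iff, Set.mem_singleton_iff,
        forall_eq]
      exact eq_comm
    exact (hH σ).1 <| stabilizer_le_of_conj_mem hn ((hH _).2 h1)
      (fun τ hτ => (hH _).2 (commute_conj h2 ((hH τ).1 hτ))) hσ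
  have hidem : η * η = η := by
    have hb := hstab (Fin.cycleIcc ⟨1, by omega⟩ ⟨n - 1, by omega⟩)⁻¹ (by
      rw [Perm.inv_eq_iff_eq, Fin.cycleIcc_of_lt]; simp [Fin.lt_def])
    rw [hb.eq] at h2
    have h := congrArg (· * ψ (Fin.cycleIcc ⟨1, by omega⟩ ⟨n - 1, by omega⟩)) h2
    simp only [mul_assoc, map_inv_mul_map, mul_one] at h
    rw [← pow_two, ← h]
  refine ⟨hidem, hstab, ⟨0, by omega⟩, ⟨1, by omega⟩, by simp, ?_⟩
  rw [conjIdem_self]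
  exact commute_and_absorb_of_rel (map_swap_mul_self ψ _ _) hidem h3

end Stabilizer

/-! ### Partial permutations and presented monoids -/

namespace SymInvMonoid

open Equiv

variable {n : ℕ}

@[ext]
theorem ext {f g : SymInvMonoid n} (h : ∀ x, (show Fin n ≃. Fin n from f) x =
    (show Fin n ≃. Fin n from g) x) : f = g :=
  PEquiv.ext h

instance : CoeFun (SymInvMonoid n) fun _ => Fin n → Option (Fin n) :=
  ⟨fun f => (show Fin n ≃. Fin n from f)⟩

theorem mul_apply (f g : SymInvMonoid n) (x : Fin n) : (f * g) x = (f x).bind g := rfl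

theorem one_apply (x : Fin n) : (1 : SymInvMonoid n) x = some x := rfl

theorem ofPerm_apply (σ : Perm (Fin n)) (x : Fin n) : ofPerm σ x = some (σ x) := rfl

theorem ofPerm_mul (σ τ : Perm (Fin n)) : ofPerm (σ * τ) = ofPerm τ * ofPerm σ := rfl

theorem ofPerm_one : ofPerm (1 : Perm (Fin n)) = 1 := rfl

theorem etaIdem_apply (x : Fin n) : etaIdem n x = if (x : ℕ) = 0 then none else some x := by
  change PEquiv.ofSet {i : Fin n | (i : ℕ) ≠ 0} x = _
  by_cases h : (x : ℕ) = 0 <;> simp [PEquiv.ofSet, h]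

/-- The partial permutation `f` is a restriction of the permutation `σ`. -/
def Extends (σ : Perm (Fin n)) (f : SymInvMonoid n) : Prop :=
  ∀ x y, f x = some y → σ x = y

theorem exists_extends (f : SymInvMonoid n) : ∃ σ, Extends σ f := by
  classical
  let s : Set (Fin n) := {x | f x ≠ none}
  have hinj : Set.InjOn (fun x => (f x).getD x) s := by
    intro x hx y hy hxy
    obtain ⟨a, ha⟩ := Option.ne_none_iff_exists'.1 hx
    obtain ⟨b, hb⟩ := Option.ne_none_iff_exists'.1 hy
    simp only [ha, hb, Option.getD_some] at hxy
    subst hxy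
    exact PEquiv.inj f ha hb
  obtain ⟨g, hg⟩ := Set.MapsTo.exists_equiv_extend_of_card_eq (t := Finset.univ) (s := s)
    (f := fun x => (f x).getD x) (by simp) (fun x _ => by simp) hinj
  refine ⟨g.trans (Equiv.subtypeUnivEquiv (by simp)), fun x y hxy => ?_⟩
  have := hg x (by simp [s, hxy])
  simpa [hxy] using this

theorem extends_ofPerm (σ : Perm (Fin n)) : Extends σ (ofPerm σ) := fun x y h => by
  simpa [ofPerm_apply] using h

theorem Extends.mul {σ τ : Perm (Fin n)} {f g : SymInvMonoid n} (hf : Extends σ f)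
    (hg : Extends τ g) : Extends (τ * σ) (f * g) := fun x z h => by
  rw [mul_apply, Option.bind_eq_some_iff] at h
  obtain ⟨y, hy, hz⟩ := h
  rw [Perm.mul_apply, hf x y hy, hg y z hz]

theorem Extends.eq_ofPerm {σ : Perm (Fin n)} {f : SymInvMonoid n} (hf : Extends σ f)
    (h : ∀ x, f x ≠ none) : f = ofPerm σ := by
  ext1 x
  obtain ⟨y, hy⟩ := Option.ne_none_iff_exists'.1 (h x)
  exact hy.trans (congrArg some (hf x y hy).symm)

theorem isUnit_ofPerm (σ : Perm (Fin n)) : IsUnit (ofPerm σ) :=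
  ⟨⟨ofPerm σ, ofPerm σ⁻¹, by rw [← ofPerm_mul, inv_mul_cancel, ofPerm_one],
    by rw [← ofPerm_mul, mul_inv_cancel, ofPerm_one]⟩, rfl⟩

theorem mem_symGroup_iff {f : SymInvMonoid n} : f ∈ symGroup n ↔ IsUnit f := by
  constructor
  · rintro ⟨σ, rfl⟩
    exact isUnit_ofPerm σ
  · intro hf
    obtain ⟨g, hg⟩ := hf.exists_right_inv
    obtain ⟨σ, hσ⟩ := exists_extends f
    refine ⟨σ, (hσ.eq_ofPerm fun x hx => ?_).symm⟩
    have := congrArg (fun f : SymInvMonoid n => f x) hg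
    simp [mul_apply, one_apply, hx] at this

instance : Finite (SymInvMonoid n) :=
  Finite.of_injective (fun f : SymInvMonoid n => (fun x => f x)) fun _ _ h =>
    ext fun x => congrFun h x

end SymInvMonoid

section Presentation

open Equiv

theorem DefinedMonoid.mk_eq_of_mem {A : Type*} {R : Set (FreeMonoid A × FreeMonoid A)}
    {p : FreeMonoid A × FreeMonoid A} (hp : p ∈ R) :
    DefinedMonoid.mk R p.1 = DefinedMonoid.mk R p.2 :=
  PresentedMonoid.mk_eq_mk_of_rel hp

theorem DefinedMonoid.mk_surjective {A : Type*} (R : Set (FreeMonoid A × FreeMonoid A)) :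
    Function.Surjective (DefinedMonoid.mk R) :=
  PresentedMonoid.surjective_mk

/-- A homomorphism from a free monoid that respects the relations factors through the monoid that
they define. -/
theorem DefinedMonoid.exists_lift {A M : Type*} [Monoid M]
    {R : Set (FreeMonoid A × FreeMonoid A)} (φ : FreeMonoid A →* M)
    (h : ∀ p ∈ R, φ p.1 = φ p.2) :
    ∃ F : DefinedMonoid R →* M, ∀ w, F (DefinedMonoid.mk R w) = φ w :=
  ⟨Con.lift _ φ (Con.conGen_le.2 fun u v huv => h (u, v) huv), fun _ => rfl⟩

end Presentation

/-! ### The presentation with three additional relations -/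

namespace SymInvMonoid

open Equiv

variable {n : ℕ}

theorem etaIdem_mul_self : etaIdem n * etaIdem n = etaIdem n := by
  ext1 x
  by_cases hx : (x : ℕ) = 0 <;> simp [mul_apply, etaIdem_apply, hx]

theorem commute_etaIdem {σ : Perm (Fin n)} {o : Fin n} (ho : (o : ℕ) = 0) (hσ : σ o = o) :
    ofPerm σ * etaIdem n = etaIdem n * ofPerm σ := by
  have h0 : ∀ x : Fin n, (x : ℕ) = 0 ↔ x = o := fun x => by rw [Fin.ext_iff, ho]
  have h1 : ∀ x : Fin n, σ x = o ↔ x = o := fun x => by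
    rw [← σ.injective.eq_iff (a := x), hσ]
  ext1 x
  by_cases hx : x = o <;> simp [mul_apply, etaIdem_apply, ofPerm_apply, h0, h1, hx]

theorem etaIdem_swap_rel {o i : Fin n} (ho : (o : ℕ) = 0) (hi : o ≠ i) :
    ofPerm (swap o i) * etaIdem n * ofPerm (swap o i) * etaIdem n * ofPerm (swap o i) *
      etaIdem n * ofPerm (swap o i) = etaIdem n * ofPerm (swap o i) * etaIdem n := by
  have h0 : ∀ x : Fin n, (x : ℕ) = 0 ↔ x = o := fun x => by rw [Fin.ext_iff, ho]
  ext1 x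
  by_cases hxo : x = o
  · simp [mul_apply, etaIdem_apply, ofPerm_apply, h0, hxo, hi.symm]
  by_cases hxi : x = i
  · simp [mul_apply, etaIdem_apply, ofPerm_apply, h0, hxi, hi.symm]
  · simp [mul_apply, etaIdem_apply, ofPerm_apply, h0, hxo, swap_apply_of_ne_of_ne hxo hxi]

section Realization

variable {M : Type*} [Monoid M] {ψ : Perm (Fin n) →* M} {η : M} {o : Fin n}
  {F : M →* SymInvMonoid n}

theorem map_conjIdem_apply (ho : (o : ℕ) = 0) (hψ : ∀ σ, F (ψ σ) = ofPerm σ⁻¹)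
    (hη : F η = etaIdem n) (i x : Fin n) :
    F (conjIdem ψ η o i) x = if x = i then none else some x := by
  have h0 : ∀ x : Fin n, (x : ℕ) = 0 ↔ x = o := fun x => by rw [Fin.ext_iff, ho]
  have h1 : swap o i x = o ↔ x = i := by
    rw [← (swap o i).injective.eq_iff (a := x) (b := i), swap_apply_right]
  rw [conjIdem, map_mul, map_mul, hψ, hη, swap_inv]
  by_cases hx : x = i <;> simp [mul_apply, etaIdem_apply, ofPerm_apply, h0, h1, hx]

theorem map_listIdem_apply (ho : (o : ℕ) = 0) (hψ : ∀ σ, F (ψ σ) = ofPerm σ⁻¹)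
    (hη : F η = etaIdem n) (l : List (Fin n)) (x : Fin n) :
    F (listIdem ψ η o l) x = if x ∈ l then none else some x := by
  induction l with
  | nil => simp [one_apply]
  | cons i l ih =>
    rw [listIdem_cons, map_mul, mul_apply, map_conjIdem_apply ho hψ hη]
    by_cases hx : x = i <;> simp [hx, ih]

theorem map_normalForm_apply (ho : (o : ℕ) = 0) (hψ : ∀ σ, F (ψ σ) = ofPerm σ⁻¹)
    (hη : F η = etaIdem n) (l : List (Fin n)) (σ : Perm (Fin n)) (x : Fin n) :
    F (listIdem ψ η o l * ψ σ) x = if x ∈ l then none else some (σ⁻¹ x) := by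
  rw [map_mul, mul_apply, map_listIdem_apply ho hψ hη, hψ]
  by_cases hx : x ∈ l <;> simp [hx, ofPerm_apply]

/-- Normal forms with equal images are equal, and every partial permutation is the image of the
normal form given by the complement of its domain and a permutation extending it. -/
theorem bijective_of_isPuncture (h : IsPuncture ψ η o) (ho : (o : ℕ) = 0)
    (hψ : ∀ σ, F (ψ σ) = ofPerm σ⁻¹) (hη : F η = etaIdem n)
    (hgen : Submonoid.closure (insert η (Set.range ψ)) = ⊤) : Function.Bijective F := by
  constructor
  · intro a b hab
    obtain ⟨k, σ, rfl⟩ := h.exists_listIdem_mul hgen a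
    obtain ⟨l, τ, rfl⟩ := h.exists_listIdem_mul hgen b
    have hx : ∀ x, (if x ∈ k then none else some (σ⁻¹ x)) =
        (if x ∈ l then none else some (τ⁻¹ x)) := fun x => by
      rw [← map_normalForm_apply ho hψ hη, ← map_normalForm_apply ho hψ hη, hab]
    refine h.listIdem_mul_eq (fun i => ?_) fun x hxl => ?_
    · have := hx i
      by_cases hk : i ∈ k <;> by_cases hl : i ∈ l <;> simp_all
    · have := hx x
      by_cases hk : x ∈ k <;> simp_all
  · intro f
    obtain ⟨σ, hσ⟩ := exists_extends f
    refine ⟨listIdem ψ η o (Finset.univ.filter fun x => f x = none).toList * ψ σ⁻¹, ?_⟩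
    ext1 x
    refine (map_normalForm_apply ho hψ hη _ _ x).trans ?_
    by_cases hx : f x = none
    · simp [hx]
    · obtain ⟨y, hy⟩ := Option.ne_none_iff_exists'.1 hx
      simp [hy, hσ x y hy]

end Realization

end SymInvMonoid

section ExtendedPresentation

open Equiv SymInvMonoid

variable {n : ℕ} {A : Type*} {R : Set (FreeMonoid A × FreeMonoid A)}

/-- The extended presentation defines the symmetric inverse monoid; this holds for `n = 3` as well,
where `(2,3)` and `(2,…,n)` coincide. -/
theorem exists_mulEquiv_extraRels (hn : 3 ≤ n) (e : DefinedMonoid R ≃* symGroup n)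
    (s b t : FreeMonoid A)
    (hs : e (DefinedMonoid.mk R s) = symGroup.ofPerm (swap ⟨1, by omega⟩ ⟨2, by omega⟩))
    (hb : e (DefinedMonoid.mk R b) =
      symGroup.ofPerm (Fin.cycleIcc ⟨1, by omega⟩ ⟨n - 1, by omega⟩))
    (ht : e (DefinedMonoid.mk R t) = symGroup.ofPerm (swap ⟨0, by omega⟩ ⟨1, by omega⟩)) :
    ∃ f : DefinedMonoid (mapRel some '' R ∪ extraRels s b t) ≃* SymInvMonoid n,
      (∀ a : A, f (DefinedMonoid.mk _ (FreeMonoid.of (some a))) =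
        (e (DefinedMonoid.mk R (FreeMonoid.of a)) : SymInvMonoid n)) ∧
      f (DefinedMonoid.mk _ (FreeMonoid.of none)) = etaIdem n := by
  set T := mapRel some '' R ∪ extraRels s b t with hT
  -- the homomorphism from the group presentation to the extended one
  obtain ⟨ι, hι⟩ := DefinedMonoid.exists_lift (R := R)
    ((DefinedMonoid.mk T).comp (FreeMonoid.map some)) fun p hp =>
      DefinedMonoid.mk_eq_of_mem (p := mapRel some p) (Or.inl ⟨p, hp, rfl⟩)
  -- permutations multiply from left to right in `symGroup n`, hence the inverse
  let ψ : Perm (Fin n) →* DefinedMonoid T :=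
    { toFun := fun σ => ι (e.symm (symGroup.ofPerm σ⁻¹))
      map_one' := by
        have : symGroup.ofPerm (1 : Perm (Fin n))⁻¹ = 1 := rfl
        rw [this, map_one, map_one]
      map_mul' := fun σ τ => by
        have : symGroup.ofPerm (σ * τ)⁻¹ = symGroup.ofPerm σ⁻¹ * symGroup.ofPerm τ⁻¹ := by
          rw [mul_inv_rev]; rfl
        rw [this, map_mul, map_mul] }
  have hψ : ∀ (w : FreeMonoid A) (σ : Perm (Fin n)),
      e (DefinedMonoid.mk R w) = symGroup.ofPerm σ⁻¹ →
        DefinedMonoid.mk T (FreeMonoid.map some w) = ψ σ := fun w σ h => by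
    change _ = ι (e.symm (symGroup.ofPerm σ⁻¹))
    rw [← h, e.symm_apply_apply, hι]
    rfl
  obtain ⟨η, hη⟩ : ∃ η, η = DefinedMonoid.mk T (FreeMonoid.of none) := ⟨_, rfl⟩
  have hsψ := hψ s (swap ⟨1, by omega⟩ ⟨2, by omega⟩) (by rw [hs, swap_inv])
  have hbψ := hψ b (Fin.cycleIcc ⟨1, by omega⟩ ⟨n - 1, by omega⟩)⁻¹ (by rw [hb, inv_inv])
  have htψ := hψ t (swap ⟨0, by omega⟩ ⟨1, by omega⟩) (by rw [ht, swap_inv])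
  have hpun : IsPuncture ψ η ⟨0, by omega⟩ := by
    apply isPuncture_of_rels hn
    · have := DefinedMonoid.mk_eq_of_mem (R := T) (p := (FreeMonoid.map some s * FreeMonoid.of none,
        FreeMonoid.of none * FreeMonoid.map some s)) (by simp [hT, extraRels])
      simpa only [map_mul, hsψ, ← hη] using! this
    · have := DefinedMonoid.mk_eq_of_mem (R := T) (p := (FreeMonoid.map some b * FreeMonoid.of none,
        FreeMonoid.of none ^ 2 * FreeMonoid.map some b)) (by simp [hT, extraRels])
      simpa only [map_mul, map_pow, hbψ, ← hη] using this
    · have := DefinedMonoid.mk_eq_of_mem (R := T)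
        (p := (FreeMonoid.map some t * FreeMonoid.of none * FreeMonoid.map some t *
          FreeMonoid.of none * FreeMonoid.map some t * FreeMonoid.of none * FreeMonoid.map some t,
          FreeMonoid.of none * FreeMonoid.map some t * FreeMonoid.of none))
        (by simp [hT, extraRels])
      simpa only [map_mul, htψ, ← hη] using this
  -- the homomorphism to the symmetric inverse monoid
  let φ : FreeMonoid (Option A) →* SymInvMonoid n :=
    FreeMonoid.lift fun c => c.elim (etaIdem n) fun a =>
      (e (DefinedMonoid.mk R (FreeMonoid.of a)) : SymInvMonoid n)
  have hφA : ∀ w : FreeMonoid A,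
      φ (FreeMonoid.map some w) = (e (DefinedMonoid.mk R w) : SymInvMonoid n) := fun w => by
    have : φ.comp (FreeMonoid.map some) =
        ((symGroup n).subtype.comp e.toMonoidHom).comp (DefinedMonoid.mk R) :=
      FreeMonoid.hom_eq fun a => by simp [φ]
    exact DFunLike.congr_fun this w
  have hφη : φ (FreeMonoid.of none) = etaIdem n := by simp [φ]
  have hφs := (hφA s).trans (congrArg Subtype.val hs)
  have hφb := (hφA b).trans (congrArg Subtype.val hb)
  have hφt := (hφA t).trans (congrArg Subtype.val ht)
  obtain ⟨F, hF⟩ := DefinedMonoid.exists_lift (R := T) φ (by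
    rintro p (⟨q, hq, rfl⟩ | hp)
    · change φ (FreeMonoid.map some q.1) = φ (FreeMonoid.map some q.2)
      rw [hφA, hφA, DefinedMonoid.mk_eq_of_mem hq]
    · simp only [extraRels, Set.mem_insert_iff, Set.mem_singleton_iff] at hp
      rcases hp with rfl | rfl | rfl <;> simp only [map_mul, map_pow, hφη, hφs, hφb, hφt]
      · exact commute_etaIdem (o := ⟨0, by omega⟩) rfl
          (swap_apply_of_ne_of_ne (by simp) (by simp))
      · rw [pow_two, etaIdem_mul_self]
        exact commute_etaIdem (o := ⟨0, by omega⟩) rfl (Fin.cycleIcc_of_lt (by simp [Fin.lt_def]))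
      · exact etaIdem_swap_rel rfl (by simp))
  have hFψ : ∀ σ, F (ψ σ) = ofPerm σ⁻¹ := fun σ => by
    obtain ⟨w, hw⟩ := DefinedMonoid.mk_surjective R (e.symm (symGroup.ofPerm σ⁻¹))
    have hw' : e (DefinedMonoid.mk R w) = symGroup.ofPerm σ⁻¹ := by rw [hw, e.apply_symm_apply]
    rw [← hψ w σ hw', hF, hφA, hw']
    rfl
  have hgen : Submonoid.closure (insert η (Set.range ψ)) = ⊤ := by
    rw [eq_top_iff]
    intro m _
    obtain ⟨w, rfl⟩ := DefinedMonoid.mk_surjective T m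
    induction w with
    | one => rw [map_one]; exact Submonoid.one_mem _
    | mul u v hu hv =>
      rw [map_mul]
      exact Submonoid.mul_mem _ (hu trivial) (hv trivial)
    | of c =>
      apply Submonoid.subset_closure
      cases c with
      | none => exact Or.inl hη.symm
      | some a =>
        obtain ⟨σ, hσ⟩ := (e (DefinedMonoid.mk R (FreeMonoid.of a))).2
        refine Or.inr ⟨σ⁻¹, (hψ (FreeMonoid.of a) σ⁻¹ ?_).symm⟩
        rw [inv_inv]
        exact Subtype.ext hσ.symm
  refine ⟨MulEquiv.ofBijective F (bijective_of_isPuncture hpun rfl hFψ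
    (by rw [hη, hF, hφη]) hgen), fun a => ?_, ?_⟩
  · rw [MulEquiv.ofBijective_apply, hF, ← hφA, FreeMonoid.map_of]
  · rw [MulEquiv.ofBijective_apply, hF, hφη]

end ExtendedPresentation

/-! ### Ranks, extensions and values of words -/

namespace SymInvMonoid

open Equiv

variable {n : ℕ}

/-- The partial permutation `f` extends to only one permutation; equivalently, its rank is at least
`n - 1`. -/
def HasUniqueExtension (f : SymInvMonoid n) : Prop :=
  ∀ σ τ, Extends σ f → Extends τ f → σ = τ

/-- The sign of a permutation extending `f`. It depends on a choice, unless `f` has a unique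
extension. -/
noncomputable def extSign (f : SymInvMonoid n) : ℤˣ :=
  Perm.sign (exists_extends f).choose

theorem HasUniqueExtension.extSign_eq {f : SymInvMonoid n} (hf : HasUniqueExtension f)
    {σ : Perm (Fin n)} (hσ : Extends σ f) : extSign f = Perm.sign σ := by
  rw [extSign, hf _ _ (exists_extends f).choose_spec hσ]

/-- The partial permutations without a unique extension form an ideal. -/
theorem HasUniqueExtension.of_mul {f g : SymInvMonoid n} (h : HasUniqueExtension (f * g)) :
    HasUniqueExtension f ∧ HasUniqueExtension g := by
  obtain ⟨σ, hσ⟩ := exists_extends f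
  obtain ⟨τ, hτ⟩ := exists_extends g
  exact ⟨fun σ σ' h1 h2 => mul_left_cancel (h _ _ (h1.mul hτ) (h2.mul hτ)),
    fun τ τ' h1 h2 => mul_right_cancel (h _ _ (hσ.mul h1) (hσ.mul h2))⟩

theorem HasUniqueExtension.extSign_mul {f g : SymInvMonoid n} (h : HasUniqueExtension (f * g)) :
    extSign (f * g) = extSign f * extSign g := by
  obtain ⟨σ, hσ⟩ := exists_extends f
  obtain ⟨τ, hτ⟩ := exists_extends g
  rw [h.extSign_eq (hσ.mul hτ), h.of_mul.1.extSign_eq hσ, h.of_mul.2.extSign_eq hτ,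
    Perm.sign_mul, mul_comm]

theorem hasUniqueExtension_iff {f : SymInvMonoid n} :
    HasUniqueExtension f ↔ ∀ x y, f x = none → f y = none → x = y := by
  obtain ⟨σ, hσ⟩ := exists_extends f
  constructor
  · intro h x y hx hy
    -- otherwise two extensions differ by the transposition of `x` and `y`
    have hE : Extends (σ * swap x y) f := fun a b hab => by
      rw [Perm.mul_apply, swap_apply_of_ne_of_ne, hσ a b hab]
      · rintro rfl; rw [hx] at hab; cases hab
      · rintro rfl; rw [hy] at hab; cases hab
    have := h _ _ hE hσ
    rw [mul_eq_left] at this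
    simpa using (congrArg (· y) this).symm.trans (swap_apply_right x y) |>.symm
  · intro h σ τ hσ hτ
    have hagree : ∀ x, f x ≠ none → σ x = τ x := fun x hx => by
      obtain ⟨y, hy⟩ := Option.ne_none_iff_exists'.1 hx
      rw [hσ x y hy, hτ x y hy]
    ext1 x
    by_cases hx : f x = none
    · by_contra hne
      -- `τ⁻¹ σ x` is another point outside the domain
      by_cases hy : f (τ⁻¹ (σ x)) = none
      · have h1 := h _ _ hx hy
        exact hne (by conv_rhs => rw [h1]
                      simp)
      · have h1 := hagree _ hy
        rw [show τ (τ⁻¹ (σ x)) = σ x from τ.apply_symm_apply _, σ.injective.eq_iff] at h1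
        rw [h1] at hy
        exact hy hx
    · exact hagree x hx

theorem _root_.IsUnit.ne_none {f : SymInvMonoid n} (hf : IsUnit f) (x : Fin n) : f x ≠ none := by
  obtain ⟨σ, rfl⟩ := mem_symGroup_iff.2 hf
  simp [ofPerm_apply]

theorem _root_.IsUnit.hasUniqueExtension {f : SymInvMonoid n} (hf : IsUnit f) :
    HasUniqueExtension f :=
  hasUniqueExtension_iff.2 fun x _ hx => absurd hx (hf.ne_none x)

theorem extSign_ofPerm (σ : Perm (Fin n)) : extSign (ofPerm σ) = Perm.sign σ :=
  (isUnit_ofPerm σ).hasUniqueExtension.extSign_eq (extends_ofPerm σ)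

theorem hasUniqueExtension_etaIdem : HasUniqueExtension (etaIdem n) :=
  hasUniqueExtension_iff.2 fun x y hx hy => by
    rw [etaIdem_apply] at hx hy
    simp only [ite_eq_left_iff, reduceCtorEq, imp_false, not_not] at hx hy
    ext; rw [hx, hy]

theorem not_isUnit_etaIdem (hn : 0 < n) : ¬ IsUnit (etaIdem n) := fun h =>
  h.ne_none ⟨0, hn⟩ (by simp [etaIdem_apply])

theorem Extends.mul_inv_mul {σ : Perm (Fin n)} {f : SymInvMonoid n} (hf : Extends σ f) :
    f * ofPerm σ⁻¹ * f = f := by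
  ext1 x
  cases hx : f x with
  | none => simp [mul_apply, hx]
  | some y => simp [mul_apply, hx, ofPerm_apply, ← hf x y hx]

/-- A partial permutation of rank `n - 1` intertwines two odd permutations: there are two points in
its domain, and they can be transposed before or after it. -/
theorem HasUniqueExtension.exists_odd (hn : 3 ≤ n) {f : SymInvMonoid n} (hf : HasUniqueExtension f)
    (hu : ¬ IsUnit f) : ∃ σ τ : Perm (Fin n), Perm.sign σ = -1 ∧ Perm.sign τ = -1 ∧
      ofPerm σ * f = f * ofPerm τ := by
  obtain ⟨ρ, hρ⟩ := exists_extends f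
  obtain ⟨i, hi⟩ : ∃ i, f i = none := by
    by_contra hcon
    push Not at hcon
    exact hu (hρ.eq_ofPerm hcon ▸ isUnit_ofPerm ρ)
  have hdom : ∀ x, x ≠ i → f x = some (ρ x) := fun x hx => by
    obtain ⟨y, hy⟩ := Option.ne_none_iff_exists'.1
      fun h => hx (hasUniqueExtension_iff.1 hf x i h hi)
    rw [hy, hρ x y hy]
  obtain ⟨⟨j, hj⟩, ⟨k, hk⟩, hjk⟩ := Fintype.exists_pair_of_one_lt_card
    (α := {x : Fin n // x ≠ i}) (by simp; omega)
  have hjk' : j ≠ k := fun h => hjk (Subtype.ext h)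
  have hfix : swap j k i = i := swap_apply_of_ne_of_ne hj.symm hk.symm
  refine ⟨swap j k, ρ * swap j k * ρ⁻¹, Perm.sign_swap hjk', ?_, ?_⟩
  · rw [Perm.sign_mul, Perm.sign_mul, Perm.sign_inv, Perm.sign_swap hjk', mul_comm, ← mul_assoc,
      Int.units_mul_self, one_mul]
  · ext1 x
    by_cases hx : x = i
    · simp [mul_apply, ofPerm_apply, hx, hfix, hi]
    · have : swap j k x ≠ i := fun h => hx ((swap j k).injective (h.trans hfix.symm))
      simp [mul_apply, ofPerm_apply, hdom _ hx, hdom _ this]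

end SymInvMonoid

section Words

open Equiv SymInvMonoid

variable {n : ℕ} {C : Type*} {T : Set (FreeMonoid C × FreeMonoid C)}

/-- The element that a word represents. -/
def wordVal {N : Type*} [Monoid N] (e : DefinedMonoid T ≃* N) : FreeMonoid C →* N :=
  e.toMonoidHom.comp (DefinedMonoid.mk T)

theorem wordVal_surjective {N : Type*} [Monoid N] (e : DefinedMonoid T ≃* N) :
    Function.Surjective (wordVal e) :=
  e.surjective.comp (DefinedMonoid.mk_surjective T)

theorem wordVal_eq_of_mem {N : Type*} [Monoid N] (e : DefinedMonoid T ≃* N)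
    {p : FreeMonoid C × FreeMonoid C} (hp : p ∈ T) : wordVal e p.1 = wordVal e p.2 :=
  congrArg e (DefinedMonoid.mk_eq_of_mem hp)

/-- Suppose that the complement of `P` is an ideal, and that `W` respects the relations whose value
satisfies `P`. Then `W` respects all equalities of elements satisfying `P`: no other relation ever
applies to a word representing such an element. -/
theorem eq_of_wordVal_eq {N K : Type*} [Monoid N] [Monoid K] (e : DefinedMonoid T ≃* N)
    {P : N → Prop} (hP : ∀ f g, P (f * g) → P f ∧ P g) (W : FreeMonoid C →* K)
    (hW : ∀ p ∈ T, P (wordVal e p.1) → W p.1 = W p.2) {u v : FreeMonoid C}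
    (huv : wordVal e u = wordVal e v) (hu : P (wordVal e u)) : W u = W v := by
  let c : Con (FreeMonoid C) :=
    { r := fun u v => wordVal e u = wordVal e v ∧ (P (wordVal e u) → W u = W v)
      iseqv := ⟨fun _ => ⟨rfl, fun _ => rfl⟩,
        fun h => ⟨h.1.symm, fun h' => (h.2 (h.1 ▸ h')).symm⟩,
        fun h h' => ⟨h.1.trans h'.1, fun h'' => (h.2 h'').trans (h'.2 (h.1 ▸ h''))⟩⟩
      mul' := fun h h' => ⟨by rw [map_mul, map_mul, h.1, h'.1], fun h'' => by
        rw [map_mul] at h''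
        rw [map_mul, map_mul, h.2 (hP _ _ h'').1, h'.2 (hP _ _ h'').2]⟩ }
  have hle : conGen (fun u v : FreeMonoid C => (u, v) ∈ T) ≤ c :=
    Con.conGen_le.2 fun u v huv => ⟨wordVal_eq_of_mem e huv, hW (u, v) huv⟩
  exact (hle (PresentedMonoid.mk_eq_mk_iff.1 (e.injective huv))).2 hu

variable (e : DefinedMonoid T ≃* SymInvMonoid n)

theorem extSign_wordVal {w : FreeMonoid C} (hw : HasUniqueExtension (wordVal e w)) :
    FreeMonoid.lift (fun c => extSign (wordVal e (FreeMonoid.of c))) w =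
      extSign (wordVal e w) := by
  induction w with
  | one => rw [map_one, map_one, ← ofPerm_one, extSign_ofPerm, Perm.sign_one]
  | of c => rw [FreeMonoid.lift_eval_of]
  | mul u v hu hv =>
    rw [map_mul] at hw
    rw [map_mul, map_mul, hw.extSign_mul, hu hw.of_mul.1, hv hw.of_mul.2]

/-- Some relation has rank at most `n - 2`. Otherwise the sign of the unique extension, which is
respected by all relations of higher rank, would define a homomorphism on the whole monoid; but the
zero absorbs odd permutations. -/
theorem exists_not_hasUniqueExtension (hn : 2 ≤ n) :
    ∃ p ∈ T, ¬ HasUniqueExtension (wordVal e p.1) := by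
  by_contra hcon
  push Not at hcon
  have hW := fun u v => eq_of_wordVal_eq (u := u) (v := v) e (P := fun _ => True)
    (fun _ _ _ => ⟨trivial, trivial⟩)
    (FreeMonoid.lift fun c => extSign (wordVal e (FreeMonoid.of c))) fun p hp _ => by
      have h1 := hcon p hp
      have h2 := h1
      rw [wordVal_eq_of_mem e hp] at h2
      rw [extSign_wordVal e h1, extSign_wordVal e h2, wordVal_eq_of_mem e hp]
  obtain ⟨z, hz⟩ := wordVal_surjective e (show SymInvMonoid n from (⊥ : Fin n ≃. Fin n))
  obtain ⟨t, ht⟩ := wordVal_surjective e (ofPerm (swap ⟨0, by omega⟩ ⟨1, by omega⟩))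
  have h := hW (z * t) z (by rw [map_mul, hz]; exact PEquiv.bot_trans _) trivial
  rw [map_mul, mul_eq_left, extSign_wordVal e, ht, extSign_ofPerm, Perm.sign_swap (by simp)] at h
  · exact absurd h (by decide)
  · rw [ht]; exact (isUnit_ofPerm _).hasUniqueExtension

variable {K : Type*} [Monoid K]

open Classical in
/-- Words in letters of rank at least `n - 1`, evaluated in a monoid `K`: a permutation is replaced
by the image of its sign under `E`, a letter `c` of rank `n - 1` by `w c` times the image of the
sign of its extension. -/
noncomputable def weight (E : ℤˣ →* K) (w : C → K) : FreeMonoid C →* K :=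
  FreeMonoid.lift fun c => if IsUnit (wordVal e (FreeMonoid.of c))
    then E (extSign (wordVal e (FreeMonoid.of c)))
    else w c * E (extSign (wordVal e (FreeMonoid.of c)))

variable {e} in
theorem weight_of_isUnit (E : ℤˣ →* K) (w : C → K) {x : FreeMonoid C}
    (hx : IsUnit (wordVal e x)) : weight e E w x = E (extSign (wordVal e x)) := by
  induction x with
  | one => rw [map_one, map_one, ← ofPerm_one, extSign_ofPerm, Perm.sign_one, map_one]
  | of c => rw [weight, FreeMonoid.lift_eval_of, if_pos hx]
  | mul u v hu hv =>
    rw [map_mul] at hx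
    rw [map_mul, map_mul, hx.hasUniqueExtension.extSign_mul, hu (IsUnit.mul_iff.1 hx).1,
      hv (IsUnit.mul_iff.1 hx).2, map_mul]

variable {e} in
theorem weight_of_not_isUnit (E : ℤˣ →* K) (w : C → K) {c : C}
    (hc : ¬ IsUnit (wordVal e (FreeMonoid.of c))) :
    weight e E w (FreeMonoid.of c) = w c * E (extSign (wordVal e (FreeMonoid.of c))) := by
  rw [weight, FreeMonoid.lift_eval_of, if_neg hc]

/-- The relations of rank `n - 1`. -/
def corankOneRels : Set (FreeMonoid C × FreeMonoid C) :=
  {p ∈ T | ¬ IsUnit (wordVal e p.1) ∧ HasUniqueExtension (wordVal e p.1)}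

variable {e} in
/-- If a weight respects the relations of rank `n - 1`, then the equalities `c ĉ⁻¹ c = c` and
`σ c = c τ`, where `ĉ` is the extension of `c` and `σ`, `τ` are odd, carry over to `K`. -/
theorem weight_idem_and_commute (hn : 3 ≤ n) {E : ℤˣ →* K} {w : C → K}
    (hW : ∀ p ∈ corankOneRels e, weight e E w p.1 = weight e E w p.2) {c : C}
    (hc : ¬ IsUnit (wordVal e (FreeMonoid.of c)))
    (hc' : HasUniqueExtension (wordVal e (FreeMonoid.of c))) :
    w c * w c = w c ∧ E (-1) * w c = w c * E (-1) := by
  have key := fun u v => eq_of_wordVal_eq (u := u) (v := v) e (P := HasUniqueExtension)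
    (fun _ _ h => h.of_mul) (weight e E w) fun p hp hp' => by
      by_cases hu : IsUnit (wordVal e p.1)
      · rw [weight_of_isUnit _ _ hu, wordVal_eq_of_mem e hp, weight_of_isUnit]
        rwa [← wordVal_eq_of_mem e hp]
      · exact hW p ⟨hp, hu, hp'⟩
  have hE : ∀ s : ℤˣ, E s * E s = 1 := fun s => by rw [← map_mul, Int.units_mul_self, map_one]
  have hcancel : ∀ (s : ℤˣ) (a b : K), a * E s = b * E s → a = b := fun s a b h => by
    have := congrArg (· * E s) h
    simpa only [mul_assoc, hE, mul_one] using this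
  constructor
  · obtain ⟨ρ, hρ⟩ := exists_extends (wordVal e (FreeMonoid.of c))
    obtain ⟨g, hg⟩ := wordVal_surjective e (ofPerm ρ⁻¹)
    have h := key (FreeMonoid.of c * g * FreeMonoid.of c) (FreeMonoid.of c)
      (by rw [map_mul, map_mul, hg, hρ.mul_inv_mul])
      (by rwa [map_mul, map_mul, hg, hρ.mul_inv_mul])
    rw [map_mul, map_mul, weight_of_not_isUnit _ _ hc,
      weight_of_isUnit _ _ (hg ▸ isUnit_ofPerm _), hg, extSign_ofPerm, Perm.sign_inv,
      hc'.extSign_eq hρ, mul_assoc (w c), hE, mul_one, ← mul_assoc] at h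
    exact hcancel _ _ _ h
  · obtain ⟨σ, τ, hσ, hτ, hστ⟩ := hc'.exists_odd hn hc
    obtain ⟨x, hx⟩ := wordVal_surjective e (ofPerm σ)
    obtain ⟨y, hy⟩ := wordVal_surjective e (ofPerm τ)
    have huniq : HasUniqueExtension (ofPerm σ * wordVal e (FreeMonoid.of c)) := by
      intro α β hα hβ
      obtain ⟨ρ, hρ⟩ := exists_extends (wordVal e (FreeMonoid.of c))
      have hcan : ofPerm σ⁻¹ * (ofPerm σ * wordVal e (FreeMonoid.of c)) =
          wordVal e (FreeMonoid.of c) := by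
        rw [← mul_assoc, ← ofPerm_mul, mul_inv_cancel, ofPerm_one, one_mul]
      have h1 := (extends_ofPerm σ⁻¹).mul hα
      have h2 := (extends_ofPerm σ⁻¹).mul hβ
      rw [hcan] at h1 h2
      exact mul_right_cancel (hc' _ _ h1 h2)
    have h := key (x * FreeMonoid.of c) (FreeMonoid.of c * y)
      (by rw [map_mul, map_mul, hx, hy, hστ]) (by rwa [map_mul, hx])
    rw [map_mul, map_mul, weight_of_not_isUnit _ _ hc,
      weight_of_isUnit _ _ (hx ▸ isUnit_ofPerm _), weight_of_isUnit _ _ (hy ▸ isUnit_ofPerm _),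
      hx, hy, extSign_ofPerm, extSign_ofPerm, hσ, hτ, mul_assoc (w c), ← map_mul,
      mul_comm _ (-1 : ℤˣ), map_mul, ← mul_assoc, ← mul_assoc] at h
    exact hcancel _ _ _ h

end Words

/-! ### Weights of words and the lower bound -/

section Weights

open Equiv SymInvMonoid

/-- The embedding of the group of signs into the `2 × 2` matrices over the field with two elements
that takes `-1` to the exchange of the coordinates. -/
def signMatrix : ℤˣ →* Matrix (Fin 2) (Fin 2) (ZMod 2) where
  toFun s := if s = 1 then 1 else !![0, 1; 1, 0]
  map_one' := rfl
  map_mul' := by decide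

/-- One equation `x₀ z x₁ = y₀ z y₁ z y₂` between words with coefficients in the group of signs
does not force `z` to commute with `-1`. After moving the coefficients to the right-hand side the
equation is `z = h₀ z h₁ z h₂` with `h₀ h₁ h₂ = 1`. For `h₂ = 1` a matrix with equal rows is a
solution, for `h₀ = 1` its transpose is, and for `h₀ = h₂ = -1` a matrix of order `3` is, which
the exchange of the coordinates inverts. -/
theorem exists_signMatrix_solution {x₀ x₁ y₀ y₁ y₂ s : ℤˣ}
    (h : x₀ * s * x₁ = y₀ * s * y₁ * s * y₂) :
    ∃ z : Matrix (Fin 2) (Fin 2) (ZMod 2),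
      signMatrix x₀ * (z * signMatrix s) * signMatrix x₁ =
        signMatrix y₀ * (z * signMatrix s) * signMatrix y₁ * (z * signMatrix s) * signMatrix y₂ ∧
      signMatrix (-1) * z ≠ z * signMatrix (-1) := by
  have hss : ∀ a : ℤˣ, signMatrix a * signMatrix a = 1 := fun a => by
    rw [← map_mul, Int.units_mul_self, map_one]
  have hred : ∀ h₀ h₁ h₂ : ℤˣ, h₀ * h₁ * h₂ = 1 → ∃ z : Matrix (Fin 2) (Fin 2) (ZMod 2),
      z = signMatrix h₀ * z * signMatrix h₁ * z * signMatrix h₂ ∧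
      signMatrix (-1) * z ≠ z * signMatrix (-1) := by
    intro h₀ h₁ h₂ h1
    rcases Int.units_eq_one_or h₂ with rfl | rfl
    · exact ⟨!![1, 0; 1, 0], by revert h₀ h₁; decide, by decide⟩
    rcases Int.units_eq_one_or h₀ with rfl | rfl
    · exact ⟨!![1, 1; 0, 0], by revert h₁; decide, by decide⟩
    · exact ⟨!![0, 1; 1, 1], by revert h₁; decide, by decide⟩
  obtain ⟨z, hz, hz'⟩ := hred (x₀ * y₀) (s * y₁) (s * y₂ * x₁ * s) (by
    have h1 := congrArg (x₀ * s * x₁ * ·) h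
    simp only [Int.units_mul_self] at h1
    rw [h1]
    simp only [mul_comm, mul_left_comm])
  refine ⟨z, ?_, hz'⟩
  conv_lhs => rw [hz]
  simp only [map_mul]
  have h1 : ∀ (a : ℤˣ) (m : Matrix (Fin 2) (Fin 2) (ZMod 2)),
      signMatrix a * (signMatrix a * m) = m := fun a m => by rw [← mul_assoc, hss, one_mul]
  simp only [mul_assoc, h1, hss, mul_one]

variable {n : ℕ} {C : Type*} {T : Set (FreeMonoid C × FreeMonoid C)}
  (e : DefinedMonoid T ≃* SymInvMonoid n)

/-- The number of letters of a word that do not represent permutations. -/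
noncomputable def corankCount (x : FreeMonoid C) : ℕ :=
  (weight e 1 (fun _ => Multiplicative.ofAdd 1) x).toAdd

theorem corankCount_mul (x y : FreeMonoid C) :
    corankCount e (x * y) = corankCount e x + corankCount e y := by
  simp [corankCount]

variable {e}

theorem weight_one_const {K : Type*} [Monoid K] (k : K) (x : FreeMonoid C) :
    weight e 1 (fun _ => k) x = k ^ corankCount e x := by
  induction x with
  | one => simp [corankCount]
  | mul x y hx hy => rw [map_mul, corankCount_mul, pow_add, hx, hy]
  | of c =>
    by_cases hc : IsUnit (wordVal e (FreeMonoid.of c))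
    · simp [corankCount, weight_of_isUnit _ _ hc]
    · simp [corankCount, weight_of_not_isUnit _ _ hc]

theorem isUnit_of_corankCount {x : FreeMonoid C} (hx : corankCount e x = 0) :
    IsUnit (wordVal e x) := by
  induction x with
  | one => rw [map_one]; exact isUnit_one
  | mul x y ihx ihy =>
    rw [corankCount_mul, Nat.add_eq_zero_iff] at hx
    rw [map_mul]
    exact (ihx hx.1).mul (ihy hx.2)
  | of c =>
    by_contra hc
    simp [corankCount, weight_of_not_isUnit _ _ hc] at hx

/-- A word is split at its first letter that does not represent a permutation. -/
theorem exists_eq_mul_of_corankCount {x : FreeMonoid C} {k : ℕ} (hx : corankCount e x = k + 1) :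
    ∃ (a : FreeMonoid C) (c : C) (y : FreeMonoid C), x = a * FreeMonoid.of c * y ∧
      IsUnit (wordVal e a) ∧ ¬ IsUnit (wordVal e (FreeMonoid.of c)) ∧ corankCount e y = k := by
  induction x using FreeMonoid.recOn with
  | one => simp [corankCount] at hx
  | of_mul c x ih =>
    by_cases hc : IsUnit (wordVal e (FreeMonoid.of c))
    · have hc0 : corankCount e (FreeMonoid.of c) = 0 := by
        simp [corankCount, weight_of_isUnit _ _ hc]
      rw [corankCount_mul, hc0, zero_add] at hx
      obtain ⟨a, d, y, rfl, ha, hd, hy⟩ := ih hx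
      exact ⟨FreeMonoid.of c * a, d, y, by simp only [mul_assoc],
        by rw [map_mul]; exact hc.mul ha, hd, hy⟩
    · have hc1 : corankCount e (FreeMonoid.of c) = 1 := by
        simp [corankCount, weight_of_not_isUnit _ _ hc]
      rw [corankCount_mul, hc1, add_comm, Nat.add_right_cancel_iff] at hx
      exact ⟨1, c, x, by rw [one_mul], by rw [map_one]; exact isUnit_one, hc, hx⟩

/-- A single relation `u = v` of rank `n - 1` is not enough, the case of a word `u` with only one
letter of rank `n - 1`. Counting letters modulo the difference of the counts shows that `v` has two
such letters, counting them with integral weights shows that all three letters agree, and then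
`exists_signMatrix_solution` gives a weight that contradicts `h`. -/
theorem not_respects_of_corankCount_eq_one {u v : FreeMonoid C}
    (huv : wordVal e u = wordVal e v) (hu : HasUniqueExtension (wordVal e u))
    (hu1 : corankCount e u = 1) (hv : corankCount e v ≠ 0)
    (h : ∀ (K : Type) [Monoid K] (E : ℤˣ →* K) (w : C → K), weight e E w u = weight e E w v →
      ∀ c, ¬ IsUnit (wordVal e (FreeMonoid.of c)) →
        HasUniqueExtension (wordVal e (FreeMonoid.of c)) →
        w c * w c = w c ∧ E (-1) * w c = w c * E (-1)) : False := by
  obtain ⟨x₀, c, x₁, rfl, hx₀, hc, hx₁⟩ := exists_eq_mul_of_corankCount hu1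
  replace hx₁ := isUnit_of_corankCount hx₁
  have hc' : HasUniqueExtension (wordVal e (FreeMonoid.of c)) := by
    rw [map_mul, map_mul] at hu
    exact hu.of_mul.1.of_mul.2
  have hv2 : corankCount e v = 2 := by
    obtain ⟨k, hk⟩ := Nat.exists_eq_succ_of_ne_zero hv
    have hone := (h (Multiplicative (ZMod k)) 1 (fun _ => Multiplicative.ofAdd 1) (by
      rw [weight_one_const, weight_one_const, hu1, hk, ← ofAdd_nsmul, ← ofAdd_nsmul]
      simp) c hc hc').1
    have : (1 : ZMod k) = 0 := by
      simpa using congrArg Multiplicative.toAdd hone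
    rw [hk, ZMod.one_eq_zero_iff.1 this]
  obtain ⟨y₀, d, v', rfl, hy₀, hd, hv'⟩ := exists_eq_mul_of_corankCount hv2
  obtain ⟨y₁, d', y₂, rfl, hy₁, hd', hy₂⟩ := exists_eq_mul_of_corankCount hv'
  replace hy₂ := isUnit_of_corankCount hy₂
  have hwu : ∀ (K : Type) [Monoid K] (E : ℤˣ →* K) (w : C → K),
      weight e E w (x₀ * FreeMonoid.of c * x₁) = E (extSign (wordVal e x₀)) *
        (w c * E (extSign (wordVal e (FreeMonoid.of c)))) * E (extSign (wordVal e x₁)) := by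
    intro K _ E w
    rw [map_mul, map_mul, weight_of_isUnit _ _ hx₀, weight_of_isUnit _ _ hx₁,
      weight_of_not_isUnit _ _ hc]
  have hwv : ∀ (K : Type) [Monoid K] (E : ℤˣ →* K) (w : C → K),
      weight e E w (y₀ * FreeMonoid.of d * (y₁ * FreeMonoid.of d' * y₂)) =
        E (extSign (wordVal e y₀)) * (w d * E (extSign (wordVal e (FreeMonoid.of d)))) *
        E (extSign (wordVal e y₁)) * (w d' * E (extSign (wordVal e (FreeMonoid.of d')))) *
        E (extSign (wordVal e y₂)) := by
    intro K _ E w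
    simp only [map_mul, weight_of_isUnit _ _ hy₀, weight_of_isUnit _ _ hy₁,
      weight_of_isUnit _ _ hy₂, weight_of_not_isUnit _ _ hd, weight_of_not_isUnit _ _ hd',
      mul_assoc]
  classical
  have hint : ∀ w : C → Multiplicative ℤ, w c = w d * w d' → w c = 1 := fun w hw => by
    have := (h _ 1 w (by simp [hwu, hwv, hw]) c hc hc').1
    rwa [mul_eq_left] at this
  have hdd : d = c ∧ d' = c := by
    by_cases h1 : d = c <;> by_cases h2 : d' = c
    · exact ⟨h1, h2⟩
    · have := hint (fun x => if x = c then Multiplicative.ofAdd 1 else 1) (by simp [h1, h2])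
      simp at this
    · have := hint (fun x => if x = c then Multiplicative.ofAdd 1 else 1) (by simp [h1, h2])
      simp at this
    · have := hint (fun x => if x = c then Multiplicative.ofAdd 2 else Multiplicative.ofAdd 1)
        (by simp only [h1, h2, if_true, if_false]; rfl)
      simp at this
  obtain ⟨rfl, rfl⟩ := hdd
  have hsign := congrArg extSign huv
  have hv := hu
  rw [huv] at hv
  simp only [map_mul, ← mul_assoc] at hu hv hsign
  rw [hu.extSign_mul, hu.of_mul.1.extSign_mul, hv.extSign_mul, hv.of_mul.1.extSign_mul,
    hv.of_mul.1.of_mul.1.extSign_mul, hv.of_mul.1.of_mul.1.of_mul.1.extSign_mul] at hsign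
  obtain ⟨z, hz, hz'⟩ := exists_signMatrix_solution hsign
  exact hz' (h _ signMatrix (fun _ => z) (by rw [hwu, hwv, hz]) _ hc hc').2

theorem exists_corankOne_letter (hn : 0 < n) (e : DefinedMonoid T ≃* SymInvMonoid n) :
    ∃ c, ¬ IsUnit (wordVal e (FreeMonoid.of c)) ∧
      HasUniqueExtension (wordVal e (FreeMonoid.of c)) := by
  obtain ⟨w, hw⟩ := wordVal_surjective e (etaIdem n)
  have hne : corankCount e w ≠ 0 := fun h0 =>
    not_isUnit_etaIdem hn (hw ▸ isUnit_of_corankCount h0)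
  obtain ⟨k, hk⟩ := Nat.exists_eq_succ_of_ne_zero hne
  obtain ⟨a, c, y, rfl, -, hc, -⟩ := exists_eq_mul_of_corankCount hk
  have hun := hasUniqueExtension_etaIdem (n := n)
  rw [← hw, map_mul, map_mul] at hun
  exact ⟨c, hc, hun.of_mul.1.of_mul.2⟩

/-- At least two relations have rank `n - 1`. If both sides of the only such relation had two letters
of rank `n - 1`, then a nilpotent weight of those letters would respect it. -/
theorem corankOneRels_nontrivial (hn : 3 ≤ n) (e : DefinedMonoid T ≃* SymInvMonoid n) :
    (corankOneRels e).Nontrivial := by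
  by_contra hcon
  rw [Set.not_nontrivial_iff] at hcon
  obtain ⟨c, hc, hc'⟩ := exists_corankOne_letter (by omega) e
  rcases hcon.eq_empty_or_singleton with h0 | ⟨⟨u, v⟩, hp⟩
  · have := (weight_idem_and_commute hn (e := e) (E := 1)
      (w := fun _ => Multiplicative.ofAdd (1 : ℤ)) (by simp [h0]) hc hc').1
    rw [mul_eq_left] at this
    simp at this
  · have hmem : (u, v) ∈ corankOneRels e := by rw [hp]; rfl
    obtain ⟨hT, hunit, huniq⟩ := hmem
    have huv := wordVal_eq_of_mem e hT
    dsimp only at hunit huniq huv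
    have hresp : ∀ (K : Type) [Monoid K] (E : ℤˣ →* K) (w : C → K),
        weight e E w u = weight e E w v → ∀ c, ¬ IsUnit (wordVal e (FreeMonoid.of c)) →
        HasUniqueExtension (wordVal e (FreeMonoid.of c)) →
        w c * w c = w c ∧ E (-1) * w c = w c * E (-1) := by
      intro K _ E w hw c hc hc'
      exact weight_idem_and_commute hn (by simpa [hp] using hw) hc hc'
    have hu0 : corankCount e u ≠ 0 := fun h0 => hunit (isUnit_of_corankCount h0)
    have hv0 : corankCount e v ≠ 0 := fun h0 => hunit (huv ▸ isUnit_of_corankCount h0)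
    by_cases hu1 : corankCount e u = 1
    · exact not_respects_of_corankCount_eq_one huv huniq hu1 hv0 hresp
    by_cases hv1 : corankCount e v = 1
    · exact not_respects_of_corankCount_eq_one huv.symm (huv ▸ huniq) hv1 hu0
        fun K _ E w hw => hresp K E w hw.symm
    have hpow : ∀ m : ℕ, m ≠ 0 → m ≠ 1 → (2 : ZMod 4) ^ m = 0 := fun m h0 h1 => by
      obtain ⟨k, rfl⟩ := Nat.exists_eq_add_of_le (show 2 ≤ m by omega)
      rw [pow_add, show (2 : ZMod 4) ^ 2 = 0 by decide, zero_mul]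
    have := (hresp (ZMod 4) 1 (fun _ => 2) (by
      rw [weight_one_const, weight_one_const, hpow _ hu0 hu1, hpow _ hv0 hv1]) c hc hc').1
    exact absurd this (by decide)

theorem three_le_encard_nonSymRels (hn : 3 ≤ n) (e : DefinedMonoid T ≃* SymInvMonoid n) :
    3 ≤ (nonSymRels T e).encard := by
  obtain ⟨p, hp, q, hq, hpq⟩ := corankOneRels_nontrivial hn e
  obtain ⟨r, hr, hr'⟩ := exists_not_hasUniqueExtension e (by omega)
  have hrp : p ≠ r := fun h => hr' (h ▸ hp.2.2)
  have hrq : q ≠ r := fun h => hr' (h ▸ hq.2.2)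
  rw [← Set.encard_eq_three.2 ⟨p, q, r, hpq, hrp, hrq, rfl⟩]
  refine Set.encard_le_encard ?_
  rintro x (rfl | rfl | rfl)
  · exact ⟨hp.1, fun h => hp.2.1 (mem_symGroup_iff.1 h)⟩
  · exact ⟨hq.1, fun h => hq.2.1 (mem_symGroup_iff.1 h)⟩
  · exact ⟨hr, fun h => hr' (mem_symGroup_iff.1 h).hasUniqueExtension⟩

/-- The letters of `A` represent units, because they are invertible in the symmetric group. So the
relations of its presentation are between permutations. -/
theorem three_le_encard_of_extension (hn : 3 ≤ n) {A B : Type*}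
    {R : Set (FreeMonoid A × FreeMonoid A)} {S : Set (FreeMonoid (A ⊕ B) × FreeMonoid (A ⊕ B))}
    (e₀ : DefinedMonoid R ≃* symGroup n)
    (e : DefinedMonoid (mapRel Sum.inl '' R ∪ S) ≃* SymInvMonoid n) : 3 ≤ S.encard := by
  refine (three_le_encard_nonSymRels hn e).trans (Set.encard_le_encard ?_)
  rintro x ⟨⟨p, hp, rfl⟩ | hx, hx'⟩
  · obtain ⟨ι, hι⟩ := DefinedMonoid.exists_lift (R := R)
      ((DefinedMonoid.mk (mapRel Sum.inl '' R ∪ S)).comp (FreeMonoid.map Sum.inl)) fun q hq =>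
        DefinedMonoid.mk_eq_of_mem (p := mapRel Sum.inl q) (Or.inl ⟨q, hq, rfl⟩)
    refine absurd (mem_symGroup_iff.2 ?_) hx'
    obtain ⟨σ, hσ⟩ := (e₀ (DefinedMonoid.mk R p.1)).2
    have hσ' : e₀ (DefinedMonoid.mk R p.1) = symGroup.ofPerm σ := Subtype.ext hσ.symm
    have hunit : IsUnit (symGroup.ofPerm σ) := by
      refine ⟨⟨symGroup.ofPerm σ, symGroup.ofPerm σ⁻¹, Subtype.ext ?_, Subtype.ext ?_⟩, rfl⟩
      · exact (ofPerm_mul σ⁻¹ σ).symm.trans (by rw [inv_mul_cancel]; rfl)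
      · exact (ofPerm_mul σ σ⁻¹).symm.trans (by rw [mul_inv_cancel]; rfl)
    rw [← hσ', MulEquiv.isUnit_map] at hunit
    have := (hunit.map ι).map e
    rwa [hι] at this
  · exact hx

end Weights

theorem theorem1p4 :
    -- the presentation with three additional relations
    (∀ (n : ℕ) (hn : 4 ≤ n) (A : Type*) (R : Set (FreeMonoid A × FreeMonoid A))
      (e : DefinedMonoid R ≃* symGroup n) (s b t : FreeMonoid A),
      e (DefinedMonoid.mk R s) =
        symGroup.ofPerm (Equiv.swap ⟨1, by omega⟩ ⟨2, by omega⟩) →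
      e (DefinedMonoid.mk R b) =
        symGroup.ofPerm (Fin.cycleIcc ⟨1, by omega⟩ ⟨n - 1, by omega⟩) →
      e (DefinedMonoid.mk R t) =
        symGroup.ofPerm (Equiv.swap ⟨0, by omega⟩ ⟨1, by omega⟩) →
      ∃ f : DefinedMonoid (mapRel some '' R ∪ extraRels s b t) ≃* SymInvMonoid n,
        (∀ a : A, f (DefinedMonoid.mk _ (FreeMonoid.of (some a))) =
          (e (DefinedMonoid.mk R (FreeMonoid.of a)) : SymInvMonoid n)) ∧
        f (DefinedMonoid.mk _ (FreeMonoid.of none)) = etaIdem n) ∧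
    -- every presentation has at least three relations that do not represent permutations
    (∀ (n : ℕ), 3 ≤ n → ∀ (C : Type*) (T : Set (FreeMonoid C × FreeMonoid C))
      (e : DefinedMonoid T ≃* SymInvMonoid n), 3 ≤ (nonSymRels T e).encard) ∧
    -- every presentation extending one of the symmetric group adds at least three relations
    (∀ (n : ℕ), 3 ≤ n → ∀ (A B : Type*) (R : Set (FreeMonoid A × FreeMonoid A))
      (S : Set (FreeMonoid (A ⊕ B) × FreeMonoid (A ⊕ B))),
      Nonempty (DefinedMonoid R ≃* symGroup n) →
      Nonempty (DefinedMonoid (mapRel Sum.inl '' R ∪ S) ≃* SymInvMonoid n) →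
      3 ≤ S.encard) :=
  ⟨fun _ hn _ _ e s b t hs hb ht => exists_mulEquiv_extraRels (by omega) e s b t hs hb ht,
    fun _ hn _ _ e => three_le_encard_nonSymRels hn e,
    fun _ hn _ _ _ _ ⟨e₀⟩ ⟨e⟩ => three_le_encard_of_extension hn e₀ e⟩
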